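/- **Setting.** Let $M$ be a finite set of men and $W$ a finite set of women with $|M|=|W|$. Each man $m$ has a strict total order $\succ_m$ on $W$ and each woman $w$ a strict total order $\succ_w$ on $M$; let $\succ$ be the resulting profile and let $\mathrm{DA}(\succ)$ denote the matching produced by the men-proposing deferred acceptance algorithm. Put $\mu=\mathrm{DA}(\succ)$ and fix a man $m$ (the accomplice). For $X\subseteq W$, *pushing up* $X$ means that $m$ replaces his list by one in which, among the women other than $\mu(m)$, those ranked above $\mu(m)$ are exactly the women whom he truly ranks above $\mu(m)$ together with the women of $X$; the order within the part above and the part below $\mu(m)$ may be chosen arbitrarily (one fixed choice for each $X$). All other agents report truthfully, and $\mu^X$ denotes the resulting deferred acceptance matching. The *no-regret set* is $$W^{\mathrm{NR}}=\{w\in W:\ \mu^{\{w\}}(m)\succeq_m\mu(m)\}.$$ A set $Y\subseteq W^{\mathrm{NR}}$ is a *minimal no-regret push-up set* if $\mu^Y=\mu^{W^{\mathrm{NR}}}$ and no proper subset $Z\subsetneq Y$ satisfies $\mu^Z=\mu^{W^{\mathrm{NR}}}$. It is a *minimum no-regret push-up set* if $\mu^Y=\mu^{W^{\mathrm{NR}}}$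 and no $Z\subseteq W^{\mathrm{NR}}$ with $|Z|<|Y|$ satisfies $\mu^Z=\mu^{W^{\mathrm{NR}}}$. **Theorem.** Every minimal no-regret push-up set is a minimum no-regret push-up set. -/

import Mathlib

namespace StableMarriage

/-- A preference list over `α`: a strict total order, `prefers a b` meaning that `a` is ranked
strictly above `b`. -/
structure PrefList (α : Type*) where
  prefers : α → α → Prop
  irrefl : ∀ a, ¬ prefers a a
  trans : ∀ a b c, prefers a b → prefers b c → prefers a c
  total : ∀ a b, prefers a b ∨ a = b ∨ prefers b a

/-- Weak preference: `a` is ranked above `b`, or `a = b`. -/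
def PrefList.weaklyPrefers {α : Type*} (L : PrefList α) (a b : α) : Prop :=
  L.prefers a b ∨ a = b

/-- A preference profile of a stable marriage instance with equally many men and women: each man has
a complete list of the women and each woman has a complete list of the men. -/
structure Profile (M W : Type*) [Fintype M] [Fintype W] where
  card_eq : Fintype.card M = Fintype.card W
  men : M → PrefList W
  women : W → PrefList M

/-- Every nonempty set of alternatives of a finite list has a favourite. -/
theorem PrefList.exists_favourite {α : Type*} [Finite α] (L : PrefList α) (S : Set α)
    (hS : S.Nonempty) : ∃ a ∈ S, ∀ b ∈ S, L.weaklyPrefers a b := by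
  have : IsTrans α L.prefers := ⟨L.trans⟩
  have : Std.Irrefl L.prefers := ⟨L.irrefl⟩
  have wf : WellFounded L.prefers := Finite.wellFounded_of_trans_of_irrefl _
  obtain ⟨a, ha, hmin⟩ := wf.has_min S hS
  refine ⟨a, ha, fun b hb => ?_⟩
  rcases L.total a b with h | h | h
  · exact Or.inl h
  · exact Or.inr h
  · exact absurd h (hmin b hb)

theorem PrefList.weaklyPrefers_antisymm {α : Type*} (L : PrefList α) {a b : α}
    (h₁ : L.weaklyPrefers a b) (h₂ : L.weaklyPrefers b a) : a = b := by
  rcases h₁ with h₁ | h₁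
  · rcases h₂ with h₂ | h₂
    · exact absurd (L.trans _ _ _ h₁ h₂) (L.irrefl a)
    · exact h₂.symm
  · exact h₁

namespace Profile

variable {M W : Type*} [Fintype M] [Fintype W]

/-! ### The deferred acceptance algorithm

The state of the algorithm is the set `R` of pairs `(m, w)` such that `w` has already rejected `m`.
In the proposal phase every man addresses his favourite woman among those who have not rejected
him (for a man who is tentatively accepted this is the woman holding him, so only unmatched men
make new proposals); in the rejection phase every woman keeps her favourite man among those
addressing her and rejects the others. -/

/-- Given the rejections `R` so far, `w` is the favourite of `m` among the women who have not
rejected him. -/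
def Proposes (P : Profile M W) (R : Set (M × W)) (m : M) (w : W) : Prop :=
  (m, w) ∉ R ∧ ∀ w', (m, w') ∉ R → (P.men m).weaklyPrefers w w'

/-- One round: `w` rejects every proposer that she likes less than some other proposer. -/
def daStep (P : Profile M W) (R : Set (M × W)) : Set (M × W) :=
  R ∪ {q | P.Proposes R q.1 q.2 ∧ ∃ m', P.Proposes R m' q.2 ∧ (P.women q.2).prefers m' q.1}

/-- All rejections in the run of deferred acceptance. Every round before termination adds a
rejection, so the run has stopped after `|M| * |W|` rounds. -/
def daRejections (P : Profile M W) : Set (M × W) :=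
  P.daStep^[Fintype.card (M × W)] ∅

theorem subset_daStep (P : Profile M W) (R : Set (M × W)) : R ⊆ P.daStep R :=
  Set.subset_union_left

/-- The run has indeed terminated: a further round rejects nobody. -/
theorem daStep_daRejections (P : Profile M W) : P.daStep P.daRejections = P.daRejections := by
  by_contra hne
  have hfix : ∀ k ≤ Fintype.card (M × W), P.daStep (P.daStep^[k] ∅) ≠ P.daStep^[k] ∅ := by
    intro k hk h
    apply hne
    have hall : ∀ j, P.daStep^[k + j] ∅ = P.daStep^[k] ∅ := by
      intro j
      induction j with
      | zero => rfl
      | succ j ih => rw [← Nat.add_assoc, Function.iterate_succ_apply', ih, h]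
    obtain ⟨j, hj⟩ := Nat.exists_eq_add_of_le hk
    unfold daRejections
    rw [hj, hall j, h]
  have hgrow : ∀ k ≤ Fintype.card (M × W) + 1, k ≤ (P.daStep^[k] ∅).ncard := by
    intro k
    induction k with
    | zero => intro _; exact Nat.zero_le _
    | succ k ih =>
      intro hk
      have h1 := ih (by omega)
      have h2 : (P.daStep^[k] ∅).ncard < (P.daStep^[k + 1] ∅).ncard := by
        rw [Function.iterate_succ_apply']
        refine Set.ncard_lt_ncard ?_ (Set.toFinite _)
        exact (P.subset_daStep _).ssubset_of_ne (hfix k (by omega)).symm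
      omega
  have h1 := hgrow _ le_rfl
  have h2 := Set.ncard_le_card (P.daStep^[Fintype.card (M × W) + 1] ∅)
  rw [Nat.card_eq_fintype_card] at h2
  omega

theorem Proposes.unique {P : Profile M W} {R : Set (M × W)} {m : M} {w w' : W}
    (h : P.Proposes R m w) (h' : P.Proposes R m w') : w = w' :=
  (P.men m).weaklyPrefers_antisymm (h.2 _ h'.1) (h'.2 _ h.1)

/-- A woman who has rejected somebody is addressed by some man. -/
theorem exists_proposes_of_mem (P : Profile M W) (k : ℕ) :
    ∀ m w, (m, w) ∈ P.daStep^[k] ∅ → ∃ m', P.Proposes (P.daStep^[k] ∅) m' w := by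
  induction k with
  | zero => intro m w h; exact absurd h (Set.notMem_empty _)
  | succ k ih =>
    intro m w h
    rw [Function.iterate_succ_apply'] at h ⊢
    set R := P.daStep^[k] ∅
    have hne : {m' | P.Proposes R m' w}.Nonempty := by
      rcases h with h | h
      · exact ih m w h
      · exact ⟨m, h.1⟩
    obtain ⟨b, hb, hbest⟩ := (P.women w).exists_favourite _ hne
    refine ⟨b, ?_, fun w' hw' => hb.2 w' fun h' => hw' (P.subset_daStep R h')⟩
    rintro (h' | ⟨-, m', hm', hpref⟩)
    · exact hb.1 h'
    · rcases hbest m' hm' with h'' | h''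
      · exact (P.women w).irrefl _ ((P.women w).trans _ _ _ h'' hpref)
      · subst h''; exact (P.women w).irrefl _ hpref

/-- No man is rejected by all women. -/
theorem exists_proposes (P : Profile M W) (m : M) : ∃ w, P.Proposes P.daRejections m w := by
  by_contra hno
  have hall : ∀ w, (m, w) ∈ P.daRejections := by
    by_contra! hex
    obtain ⟨w, hw⟩ := hex
    obtain ⟨a, ha, hbest⟩ :=
      (P.men m).exists_favourite {w | (m, w) ∉ P.daRejections} ⟨w, hw⟩
    exact hno ⟨a, ha, hbest⟩
  choose f hf using fun w => P.exists_proposes_of_mem _ m w (hall w)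
  have hinj : Function.Injective f := by
    intro w w' h
    have h1 := hf w
    rw [h] at h1
    exact h1.unique (hf w')
  have hsurj : Function.Surjective f :=
    ((Fintype.bijective_iff_injective_and_card f).2 ⟨hinj, P.card_eq.symm⟩).2
  obtain ⟨w, hw⟩ := hsurj m
  exact hno ⟨w, hw ▸ hf w⟩

/-- At termination no two men address the same woman. -/
theorem proposes_injective (P : Profile M W) {m m' : M} {w : W}
    (h : P.Proposes P.daRejections m w) (h' : P.Proposes P.daRejections m' w) : m = m' := by
  have key : ∀ a b : M, P.Proposes P.daRejections a w → P.Proposes P.daRejections b w →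
      ¬ (P.women w).prefers a b := by
    intro a b ha hb hab
    have : (b, w) ∈ P.daStep P.daRejections := Or.inr ⟨hb, a, ha, hab⟩
    rw [P.daStep_daRejections] at this
    exact hb.1 this
  rcases (P.women w).total m m' with h1 | h1 | h1
  · exact absurd h1 (key _ _ h h')
  · exact h1
  · exact absurd h1 (key _ _ h' h)

theorem bijective_choose_proposes (P : Profile M W) :
    Function.Bijective fun m => (P.exists_proposes m).choose := by
  refine (Fintype.bijective_iff_injective_and_card _).2 ⟨fun m m' h => ?_, P.card_eq⟩
  refine P.proposes_injective (P.exists_proposes m).choose_spec ?_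
  have h' : (P.exists_proposes m).choose = (P.exists_proposes m').choose := h
  rw [h']
  exact (P.exists_proposes m').choose_spec

/-- The outcome of men-proposing deferred acceptance: each man is matched with the woman he
addresses when the algorithm has terminated. -/
noncomputable def DA (P : Profile M W) : M ≃ W :=
  Equiv.ofBijective _ P.bijective_choose_proposes

open Classical in
/-- The profile in which the man `m` reports the list `L` and everybody else reports truthfully. -/
noncomputable def withList (P : Profile M W) (m : M) (L : PrefList W) : Profile M W :=
  { P with men := Function.update P.men m L }

/-- `L'` is a list of the man `m` with true list `(A, μ(m), B)`, where `μ` is the deferred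
acceptance matching, after pushing up `X`, that is, a list `(A ∪ X, μ(m), B \ X)`.
The order within the two parts is left free. Pushing up `μ(m)` itself has no effect. -/
def IsPushUp (P : Profile M W) (m : M) (X : Finset W) (L' : PrefList W) : Prop :=
  ∀ w, w ≠ P.DA m → (L'.prefers w (P.DA m) ↔ ((P.men m).prefers w (P.DA m) ∨ w ∈ X))

/-- A choice, for every set `X` of women, of the positions at which they are placed when the man
`m` pushes up `X`. -/
def PushUpRule (P : Profile M W) (m : M) : Type _ :=
  (X : Finset W) → {L' : PrefList W // P.IsPushUp m X L'}

/-- Every set of women can be pushed up: rank the women above `μ(m)` or in `X` first, then `μ(m)`,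
then the others, each part in the true order. -/
theorem exists_isPushUp (P : Profile M W) (m : M) (X : Finset W) :
    ∃ L', P.IsPushUp m X L' := by
  classical
  let c := P.DA m
  let L := P.men m
  let t : W → ℕ := fun w => if w = c then 1 else if L.prefers w c ∨ w ∈ X then 0 else 2
  refine ⟨⟨fun a b => t a < t b ∨ (t a = t b ∧ L.prefers a b), ?_, ?_, ?_⟩, ?_⟩
  · rintro a (h | h)
    · exact lt_irrefl _ h
    · exact L.irrefl a h.2
  · rintro a b d (h | h) (h' | h')
    · exact Or.inl (h.trans h')
    · exact Or.inl (h'.1 ▸ h)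
    · exact Or.inl (h.1 ▸ h')
    · exact Or.inr ⟨h.1.trans h'.1, L.trans _ _ _ h.2 h'.2⟩
  · intro a b
    rcases lt_trichotomy (t a) (t b) with h | h | h
    · exact Or.inl (Or.inl h)
    · rcases L.total a b with h' | h' | h'
      · exact Or.inl (Or.inr ⟨h, h'⟩)
      · exact Or.inr (Or.inl h')
      · exact Or.inr (Or.inr (Or.inr ⟨h.symm, h'⟩))
    · exact Or.inr (Or.inr (Or.inl h))
  · intro w hw
    have hw' : w ≠ c := hw
    have hc : t c = 1 := if_pos rfl
    change (t w < t c ∨ (t w = t c ∧ L.prefers w c)) ↔ (L.prefers w c ∨ w ∈ X)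
    by_cases h : L.prefers w c ∨ w ∈ X
    · have : t w = 0 := by simp only [t, if_neg hw', if_pos h]
      simp [this, hc, h]
    · have : t w = 2 := by simp only [t, if_neg hw', if_neg h]
      simp [this, hc, h]

instance (P : Profile M W) (m : M) : Nonempty (P.PushUpRule m) :=
  ⟨fun X => ⟨_, (P.exists_isPushUp m X).choose_spec⟩⟩

/-- The deferred acceptance matching after the accomplice `m` pushes up `X`. -/
noncomputable def pushUpMatching (P : Profile M W) (m : M) (up : P.PushUpRule m)
    (X : Finset W) : M ≃ W :=
  (P.withList m (up X).1).DA

open Classical in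
/-- The no-regret set: the women who, when pushed up individually, do not worsen the match of the
accomplice `m` with respect to his true list. -/
noncomputable def noRegretSet (P : Profile M W) (m : M) (up : P.PushUpRule m) : Finset W :=
  Finset.univ.filter fun w =>
    (P.men m).weaklyPrefers (P.pushUpMatching m up {w} m) (P.DA m)

/-- `Y` is a set of no-regret women inducing the same matching as the whole no-regret set, and no
proper subset of `Y` induces that matching. -/
def IsMinimalNoRegretPushUpSet (P : Profile M W) (m : M) (up : P.PushUpRule m)
    (Y : Finset W) : Prop :=
  Y ⊆ P.noRegretSet m up ∧
    P.pushUpMatching m up Y = P.pushUpMatching m up (P.noRegretSet m up) ∧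
    ¬ ∃ Z : Finset W,
      P.pushUpMatching m up Z = P.pushUpMatching m up (P.noRegretSet m up) ∧ Z ⊂ Y

/-- `Y` is a set of no-regret women inducing the same matching as the whole no-regret set, and no
set of no-regret women of smaller size induces that matching. -/
def IsMinimumNoRegretPushUpSet (P : Profile M W) (m : M) (up : P.PushUpRule m)
    (Y : Finset W) : Prop :=
  Y ⊆ P.noRegretSet m up ∧
    P.pushUpMatching m up Y = P.pushUpMatching m up (P.noRegretSet m up) ∧
    ¬ ∃ Z : Finset W, Z ⊆ P.noRegretSet m up ∧
      P.pushUpMatching m up Z = P.pushUpMatching m up (P.noRegretSet m up) ∧ Z.card < Y.card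

end Profile

end StableMarriage

/-!
Let `N` be the no-regret set. By strategy-proofness, `m` keeps his partner `μ(m)` when he pushes up
a single woman of `N`. Let `cl X` consist of the women who decline `m` in every stable matching that
gives him `μ(m)` and in which all women of `X` decline him. For `X ⊆ N`, a matching of this kind
arises from `μ` and the `μ^{y}` with `y ∈ X` by giving every woman her favourite among the partners
they assign to her. With its help, strategy-proofness shows that `m` keeps `μ(m)` in `μ^X` as well,
so that `μ^X` is the worst matching of this kind for the women. It follows that `cl X` is the union
of `cl ∅` and the sets `cl {y}`, and that `μ^X = μ^N` means `N ⊆ cl X`. For a closure operator given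
by such unions, all minimal generating sets have the same size: they are systems of representatives
of the same equivalence classes of the preorder `x ∈ cl {y}`.
-/

namespace StableMarriage

section Closure

variable {α : Type*} {c : ClosureOperator (Set α)}

theorem closure_singleton_subset_of_mem {x : α} {s : Set α} (hx : x ∈ c s) : c {x} ⊆ c s :=
  c.le_closure_iff.1 (Set.singleton_subset_iff.2 hx)

theorem closure_diff_singleton_of_mem {x : α} {s : Set α} (hx : x ∈ c (s \ {x})) :
    c (s \ {x}) = c s := by
  refine (c.monotone Set.sdiff_subset).antisymm (c.le_closure_iff.1 fun y hy => ?_)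
  rcases eq_or_ne y x with rfl | hne
  · exact hx
  · exact c.le_closure _ ⟨hy, hne⟩

theorem card_le_card_of_independent {Y Z : Finset α} (hind : ∀ y ∈ Y, y ∉ c (Y \ {y}))
    (hYZ : (Y : Set α) ⊆ c Z) (hZY : (Z : Set α) ⊆ c Y)
    (hY : ∀ x ∈ c Y, x ∈ c ∅ ∨ ∃ y ∈ Y, x ∈ c {y})
    (hZ : ∀ x ∈ c Z, x ∈ c ∅ ∨ ∃ z ∈ Z, x ∈ c {z}) : Y.card ≤ Z.card := by
  have notMem_of_ne : ∀ y ∈ Y, ∀ y' ∈ Y, y' ≠ y → y ∉ c {y'} := by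
    intro y hy y' hy' hne hyy'
    have hsub : {y'} ⊆ (Y : Set α) \ {y} := Set.singleton_subset_iff.2 ⟨hy', hne⟩
    exact hind y hy (c.monotone hsub hyy')
  have notMem_empty : ∀ y ∈ Y, y ∉ c ∅ := fun y hy h =>
    hind y hy (c.monotone (Set.empty_subset _) h)
  have exists_equiv : ∀ y ∈ Y, ∃ z ∈ Z, y ∈ c {z} ∧ z ∈ c {y} := by
    intro y hy
    obtain ⟨z, hz, hyz⟩ := (hZ y (hYZ hy)).resolve_left (notMem_empty y hy)
    refine ⟨z, hz, hyz, ?_⟩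
    rcases hY z (hZY hz) with hz₀ | ⟨y', hy', hzy'⟩
    · exact absurd (closure_singleton_subset_of_mem hz₀ hyz) (notMem_empty y hy)
    · rcases eq_or_ne y' y with rfl | hne
      · exact hzy'
      · exact absurd (closure_singleton_subset_of_mem hzy' hyz) (notMem_of_ne y hy y' hy' hne)
  refine Finset.card_le_card_of_forall_subsingleton _ exists_equiv ?_
  rintro z - y ⟨hy, hyz, -⟩ y' ⟨hy', -, hzy'⟩
  by_contra hne
  exact notMem_of_ne y hy y' hy' (Ne.symm hne) (closure_singleton_subset_of_mem hzy' hyz)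

end Closure

namespace PrefList

variable {α : Type*} {L : PrefList α} {a b d : α}

theorem not_prefers : ¬ L.prefers a b ↔ L.weaklyPrefers b a := by
  constructor
  · intro h
    exact ((L.total a b).resolve_left h).symm.imp_right Eq.symm
  · rintro (h | rfl) h'
    · exact L.irrefl _ (L.trans _ _ _ h h')
    · exact L.irrefl _ h'

theorem not_weaklyPrefers : ¬ L.weaklyPrefers a b ↔ L.prefers b a :=
  not_iff_comm.1 not_prefers

theorem prefers.trans_weaklyPrefers (h : L.prefers a b) (h' : L.weaklyPrefers b d) :
    L.prefers a d := by
  rcases h' with h' | rfl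
  · exact L.trans _ _ _ h h'
  · exact h

theorem weaklyPrefers.trans_prefers (h : L.weaklyPrefers a b) (h' : L.prefers b d) :
    L.prefers a d := by
  rcases h with h | rfl
  · exact L.trans _ _ _ h h'
  · exact h'

theorem weaklyPrefers.trans (h : L.weaklyPrefers a b) (h' : L.weaklyPrefers b d) :
    L.weaklyPrefers a d := by
  rcases h with h | rfl
  · exact Or.inl (h.trans_weaklyPrefers h')
  · exact h'

end PrefList

namespace Profile

variable {M W : Type*} [Fintype M] [Fintype W] {P : Profile M W} {ν ν' : M ≃ W}

/-- `a` and `w` block the matching `ν`: each prefers the other to the partner assigned by `ν`. -/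
def Blocks (P : Profile M W) (ν : M ≃ W) (a : M) (w : W) : Prop :=
  (P.men a).prefers w (ν a) ∧ (P.women w).prefers a (ν.symm w)

/-- A matching is stable if no pair blocks it. Preference lists being complete and the two sides
equally large, matchings are bijections and individual rationality is no condition. -/
def IsStable (P : Profile M W) (ν : M ≃ W) : Prop :=
  ∀ a w, ¬ P.Blocks ν a w

/-- The common preference order of the women on matchings: no woman likes her partner in `ν` less
than her partner in `ν'`. -/
def WomenWeaklyPrefer (P : Profile M W) (ν ν' : M ≃ W) : Prop :=
  ∀ w, (P.women w).weaklyPrefers (ν.symm w) (ν'.symm w)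

theorem WomenWeaklyPrefer.antisymm (h : P.WomenWeaklyPrefer ν ν')
    (h' : P.WomenWeaklyPrefer ν' ν) : ν = ν' :=
  Equiv.symm_bijective.injective
    (Equiv.ext fun w => (P.women w).weaklyPrefers_antisymm (h w) (h' w))

theorem favourite_partner_injective {σ : W → M ≃ W} (hσ : ∀ w, P.IsStable (σ w))
    (hbest : ∀ w v, (P.women w).weaklyPrefers ((σ w).symm w) ((σ v).symm w)) :
    Function.Injective fun w => (σ w).symm w := by
  have not_prefers_of_eq : ∀ v w, (σ v).symm v = (σ w).symm w →
      ¬ (P.men ((σ v).symm v)).prefers v w := by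
    intro v w heq hpref
    refine hσ w ((σ v).symm v) v ⟨?_, ?_⟩
    · rwa [heq, Equiv.apply_symm_apply, ← heq]
    · refine ((hbest v w).resolve_right fun h => ?_)
      obtain rfl : v = w := (σ w).symm.injective (h.symm.trans heq)
      exact PrefList.irrefl _ _ hpref
  intro v w (heq : (σ v).symm v = (σ w).symm w)
  rcases (P.men ((σ v).symm v)).total v w with h | h | h
  · exact absurd h (not_prefers_of_eq v w heq)
  · exact h
  · exact absurd (heq ▸ h) (not_prefers_of_eq w v heq.symm)

theorem exists_isStable_sup {S : Set (M ≃ W)} (hne : S.Nonempty) (hS : ∀ ν ∈ S, P.IsStable ν) :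
    ∃ ν, P.IsStable ν ∧ (∀ w, ∃ ν' ∈ S, ν.symm w = ν'.symm w) ∧
      ∀ ν' ∈ S, P.WomenWeaklyPrefer ν ν' := by
  have hfav : ∀ w, ∃ ν ∈ S, ∀ ν' ∈ S, (P.women w).weaklyPrefers (ν.symm w) (ν'.symm w) := by
    intro w
    simpa only [Set.exists_mem_image, Set.forall_mem_image] using
      (P.women w).exists_favourite _ (hne.image fun ν : M ≃ W => ν.symm w)
  choose σ hσ hbest using hfav
  have hinj := favourite_partner_injective (fun w => hS _ (hσ w)) fun w v => hbest w _ (hσ v)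
  let f : W ≃ M := Equiv.ofBijective _
    ((Fintype.bijective_iff_injective_and_card _).2 ⟨hinj, P.card_eq.symm⟩)
  refine ⟨f.symm, fun a w ⟨hman, hwoman⟩ => ?_, fun w => ⟨σ w, hσ w, rfl⟩,
    fun ν' hν' w => hbest w ν' hν'⟩
  obtain ⟨v, rfl⟩ := f.surjective a
  refine hS _ (hσ v) (f v) w ⟨?_, ?_⟩
  · rw [Equiv.symm_apply_apply] at hman
    rwa [show σ v (f v) = v from (σ v).apply_symm_apply v]
  · exact hwoman.trans_weaklyPrefers (hbest w _ (hσ v))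

theorem DA_proposes (P : Profile M W) (a : M) : P.Proposes P.daRejections a (P.DA a) :=
  (P.exists_proposes a).choose_spec

theorem exists_retained_of_proposes {R : Set (M × W)} {a : M} {w : W} (h : P.Proposes R a w) :
    ∃ b, P.Proposes R b w ∧ P.Proposes (P.daStep R) b w ∧ (P.women w).weaklyPrefers b a := by
  obtain ⟨b, hb, hbest⟩ := (P.women w).exists_favourite {b | P.Proposes R b w} ⟨a, h⟩
  refine ⟨b, hb, ⟨?_, fun w' hw' => hb.2 w' fun h' => hw' (P.subset_daStep R h')⟩, hbest a h⟩
  rintro (hmem | ⟨-, b', hb', hpref⟩)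
  · exact hb.1 hmem
  · exact PrefList.not_prefers.2 (hbest b' hb') hpref

theorem exists_retained_of_mem {k : ℕ} {a : M} {w : W} (h : (a, w) ∈ P.daStep^[k + 1] ∅) :
    ∃ b, P.Proposes (P.daStep^[k] ∅) b w ∧ P.Proposes (P.daStep^[k + 1] ∅) b w ∧
      (P.women w).prefers b a := by
  suffices hpref : ∃ b, P.Proposes (P.daStep^[k] ∅) b w ∧ (P.women w).prefers b a by
    obtain ⟨b, hb, hba⟩ := hpref
    obtain ⟨b', hb', hb'', hb'b⟩ := exists_retained_of_proposes hb
    refine ⟨b', hb', ?_, hb'b.trans_prefers hba⟩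
    rwa [Function.iterate_succ_apply']
  induction k with
  | zero =>
    obtain ⟨-, b, hb, hba⟩ := h.resolve_left (Set.notMem_empty _)
    exact ⟨b, hb, hba⟩
  | succ k ih =>
    rw [Function.iterate_succ_apply'] at h
    rcases h with h | ⟨-, b, hb, hba⟩
    · obtain ⟨b, hb, hba⟩ := ih h
      obtain ⟨b', -, hb', hb'b⟩ := exists_retained_of_proposes hb
      rw [← Function.iterate_succ_apply' (f := P.daStep)] at hb'
      exact ⟨b', hb', hb'b.trans_prefers hba⟩
    · exact ⟨b, hb, hba⟩

theorem Proposes.mem_of_prefers {R : Set (M × W)} {a : M} {w w' : W} (h : P.Proposes R a w)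
    (hpref : (P.men a).prefers w' w) : (a, w') ∈ R := by
  by_contra hmem
  exact PrefList.not_prefers.2 (h.2 w' hmem) hpref

theorem DA_isStable (P : Profile M W) : P.IsStable P.DA := by
  rintro a w ⟨hman, hwoman⟩
  have hmem : (a, w) ∈ P.daStep^[Fintype.card (M × W) + 1] ∅ := by
    rw [Function.iterate_succ_apply']
    exact P.subset_daStep _ ((P.DA_proposes a).mem_of_prefers hman)
  obtain ⟨b, hb, -, hba⟩ := exists_retained_of_mem hmem
  obtain rfl : w = P.DA b := hb.unique (P.DA_proposes b)
  rw [Equiv.symm_apply_apply] at hwoman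
  exact PrefList.irrefl _ _ ((P.women _).trans _ _ _ hwoman hba)

theorem IsStable.notMem_iterate_daStep (hν : P.IsStable ν) (k : ℕ) :
    ∀ a, (a, ν a) ∉ P.daStep^[k] ∅ := by
  induction k with
  | zero => exact fun a => Set.notMem_empty _
  | succ k ih =>
    intro a h
    rw [Function.iterate_succ_apply'] at h
    obtain ⟨-, b, hb, hba⟩ := h.resolve_left (ih a)
    rcases hb.2 (ν b) (ih b) with hpref | heq
    · exact hν b (ν a) ⟨hpref, by rwa [Equiv.symm_apply_apply]⟩
    · obtain rfl : a = b := ν.injective heq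
      exact PrefList.irrefl _ _ hba

theorem IsStable.men_weaklyPrefer_DA (hν : P.IsStable ν) (a : M) :
    (P.men a).weaklyPrefers (P.DA a) (ν a) :=
  (P.DA_proposes a).2 _ (hν.notMem_iterate_daStep _ a)

theorem IsStable.womenWeaklyPrefer_DA (hν : P.IsStable ν) : P.WomenWeaklyPrefer ν P.DA := by
  intro w
  obtain ⟨a, rfl⟩ := P.DA.surjective w
  rw [Equiv.symm_apply_apply]
  rcases hν.men_weaklyPrefer_DA a with hpref | heq
  · exact PrefList.not_prefers.1 fun h => hν a (P.DA a) ⟨hpref, h⟩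
  · exact Or.inr ((Equiv.symm_apply_eq _).2 heq)

/-- The men who strictly gain when the deferred acceptance matching is replaced by `ν`. -/
def gainers (P : Profile M W) (ν : M ≃ W) : Set M :=
  {a | (P.men a).prefers (ν a) (P.DA a)}

theorem blocks_of_notMem_gainers {a b : M} (hab : P.DA b = ν a) (ha : a ∈ P.gainers ν)
    (hb : b ∉ P.gainers ν) : P.Blocks ν b (ν a) := by
  have hne : b ≠ a := fun h => hb (h ▸ ha)
  constructor
  · rw [← hab]
    exact (PrefList.not_prefers.1 hb).resolve_right fun h => hne (ν.injective (h.symm.trans hab))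
  · have hle := PrefList.not_prefers.1 fun h => P.DA_isStable a (ν a) ⟨ha, h⟩
    rw [← hab, Equiv.symm_apply_apply, hab] at hle
    rw [Equiv.symm_apply_apply]
    exact hle.resolve_right hne

theorem exists_last_stage_proposes_DA {S : Set M} {a : M} (ha : a ∈ S)
    (hfirst : ¬ P.Proposes ∅ a (P.DA a)) :
    ∃ k, (∃ b ∈ S, ¬ P.Proposes (P.daStep^[k] ∅) b (P.DA b)) ∧
      ∀ b ∈ S, P.Proposes (P.daStep^[k + 1] ∅) b (P.DA b) := by
  simpa only [not_forall, exists_prop] using Nat.exists_not_and_succ_of_not_zero_of_exists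
    (p := fun k => ∀ b ∈ S, P.Proposes (P.daStep^[k] ∅) b (P.DA b))
    (fun h => hfirst (h a ha)) ⟨_, fun b _ => P.DA_proposes b⟩

theorem exists_blocks_of_mapsTo_gainers (hne : (P.gainers ν).Nonempty)
    (hmaps : Set.MapsTo (fun a => ν.symm (P.DA a)) (P.gainers ν) (P.gainers ν)) :
    ∃ a ∉ P.gainers ν, ∃ w, P.Blocks ν a w := by
  -- The blocking woman is the one who accepts the last proposal made by a gainer: she has rejected
  -- her partner in `ν` by then, and the man she drops is no gainer.
  obtain ⟨g, hg⟩ := hne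
  obtain ⟨k, ⟨a, haG, ha⟩, hlast⟩ := exists_last_stage_proposes_DA hg
    fun h => Set.notMem_empty _ (h.mem_of_prefers hg)
  obtain ⟨b, hba⟩ := ν.surjective (P.DA a)
  have hbG : b ∈ P.gainers ν := by simpa [← hba] using hmaps haG
  have hrej : (b, ν b) ∈ P.daStep^[k + 1] ∅ := (hlast b hbG).mem_of_prefers hbG
  obtain ⟨d, hd, hd', hdb⟩ := exists_retained_of_mem hrej
  have hda : d ≠ a := fun h => ha (hba ▸ h ▸ hd)
  have hDAd : ν b ≠ P.DA d := fun h => hda (P.DA.injective (h.symm.trans hba))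
  have hdG : d ∉ P.gainers ν := fun h => hDAd (hd'.unique (hlast d h))
  have hpref : (P.men d).prefers (ν b) (P.DA d) :=
    (hd.2 _ (P.DA_isStable.notMem_iterate_daStep k d)).resolve_right hDAd
  refine ⟨d, hdG, ν b, hpref.trans_weaklyPrefers (PrefList.not_prefers.1 hdG), ?_⟩
  rwa [Equiv.symm_apply_apply]

/-- Known as the blocking lemma, due to J. S. Hwang. -/
theorem exists_blocks_of_gainers_nonempty (hne : (P.gainers ν).Nonempty) :
    ∃ a ∉ P.gainers ν, ∃ w, P.Blocks ν a w := by
  by_cases hmaps : Set.MapsTo (ν.trans P.DA.symm) (P.gainers ν) (P.gainers ν)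
  · exact exists_blocks_of_mapsTo_gainers hne (Equiv.Perm.perm_symm_mapsTo_of_mapsTo _ hmaps)
  · simp only [Set.MapsTo, not_forall] at hmaps
    obtain ⟨a, ha, hb⟩ := hmaps
    exact ⟨_, hb, _, blocks_of_notMem_gainers (P.DA.apply_symm_apply _) ha hb⟩

variable {m : M} {L L' : PrefList W} {X X' : Set W}

theorem withList_men_self : (P.withList m L).men m = L := by
  simp [withList]

theorem withList_withList : (P.withList m L).withList m L' = P.withList m L' := by
  simp [withList]

theorem blocks_withList_of_ne {a : M} {w : W} (ha : a ≠ m) :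
    (P.withList m L).Blocks ν a w ↔ P.Blocks ν a w := by
  simp [Blocks, withList, ha]

theorem DA_strategyproof (P : Profile M W) (m : M) (L : PrefList W) :
    ¬ (P.men m).prefers ((P.withList m L).DA m) (P.DA m) := by
  intro hm
  obtain ⟨a, ha, w, hblocks⟩ := exists_blocks_of_gainers_nonempty ⟨m, hm⟩
  have hne : a ≠ m := fun h => ha (h ▸ hm)
  exact (P.withList m L).DA_isStable a w ((blocks_withList_of_ne hne).2 hblocks)

/-- In the matching `ν`, the woman `w` would not leave her partner for `m`. This includes the case
that `m` is her partner. -/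
def Declines (P : Profile M W) (m : M) (ν : M ≃ W) (w : W) : Prop :=
  (P.women w).weaklyPrefers (ν.symm w) m

theorem Declines.mono {w : W} (h : P.Declines m ν' w) (hle : P.WomenWeaklyPrefer ν ν') :
    P.Declines m ν w :=
  (hle w).trans h

/-- The matchings that remain possible when `m` pushes up `X` without losing his deferred acceptance
partner: the stable matchings with this partner in which no woman of `X` would leave her partner
for `m`. -/
structure IsAdmissible (P : Profile M W) (m : M) (X : Set W) (ν : M ≃ W) : Prop where
  isStable : P.IsStable ν
  apply_eq : ν m = P.DA m
  declines : ∀ x ∈ X, P.Declines m ν x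

theorem IsAdmissible.mono (h : P.IsAdmissible m X ν) (hX : X' ⊆ X) : P.IsAdmissible m X' ν :=
  ⟨h.isStable, h.apply_eq, fun x hx => h.declines x (hX hx)⟩

theorem DA_isAdmissible_empty (P : Profile M W) (m : M) : P.IsAdmissible m ∅ P.DA :=
  ⟨P.DA_isStable, rfl, fun _ hx => absurd hx (Set.notMem_empty _)⟩

theorem exists_isAdmissible_sup {S : Set (M ≃ W)} (hne : S.Nonempty)
    (hS : ∀ ν ∈ S, P.IsAdmissible m ∅ ν) (hX : ∀ x ∈ X, ∃ ν ∈ S, P.Declines m ν x) :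
    ∃ ν, P.IsAdmissible m X ν ∧ ∀ w, P.Declines m ν w → ∃ ν' ∈ S, P.Declines m ν' w := by
  obtain ⟨ν, hν, hsel, hle⟩ := exists_isStable_sup hne fun ν' hν' => (hS ν' hν').isStable
  refine ⟨ν, ⟨hν, ?_, fun x hx => ?_⟩, fun w hw => ?_⟩
  · obtain ⟨ν', hν', heq⟩ := hsel (P.DA m)
    rwa [← (hS ν' hν').apply_eq, Equiv.symm_apply_apply, Equiv.symm_apply_eq, eq_comm,
      (hS ν' hν').apply_eq] at heq
  · obtain ⟨ν', hν', hx'⟩ := hX x hx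
    exact hx'.mono (hle ν' hν')
  · obtain ⟨ν', hν', heq⟩ := hsel w
    exact ⟨ν', hν', by rwa [Declines, heq] at hw⟩

/-- The closure operator sending `X` to the set of women who decline `m` whenever all women of `X`
do, in the stable matchings that give `m` his deferred acceptance partner. -/
def declineClosure (P : Profile M W) (m : M) : ClosureOperator (Set W) :=
  ClosureOperator.mk₂ (fun X => {w | ∀ ν, P.IsAdmissible m X ν → P.Declines m ν w})
    (fun _ x hx _ hν => hν.declines x hx)
    (fun _ _ hXY _ hw ν hν => hw ν ⟨hν.isStable, hν.apply_eq, fun _ hx => hXY hx ν hν⟩)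

theorem IsAdmissible.mem_declineClosure_iff {w : W} (h : P.IsAdmissible m X ν)
    (hleast : ∀ ν', P.IsAdmissible m X ν' → P.WomenWeaklyPrefer ν' ν) :
    w ∈ P.declineClosure m X ↔ P.Declines m ν w :=
  ⟨fun hw => hw ν h, fun hw ν' hν' => hw.mono (hleast ν' hν')⟩

theorem mem_declineClosure_empty {w : W} (h : P.Declines m P.DA w) :
    w ∈ P.declineClosure m ∅ :=
  ((P.DA_isAdmissible_empty m).mem_declineClosure_iff
    fun _ hν => hν.isStable.womenWeaklyPrefer_DA).2 h

variable {up : P.PushUpRule m} {F : Finset W}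

theorem IsPushUp.blocks_withList_iff {w : W} (hL : P.IsPushUp m F L) (hm : ν m = P.DA m) :
    (P.withList m L).Blocks ν m w ↔ P.Blocks ν m w ∨ (w ∈ F ∧ ¬ P.Declines m ν w) := by
  rw [Declines, PrefList.not_weaklyPrefers, Blocks, Blocks, withList_men_self, hm, ← or_and_right]
  refine and_congr_left fun hw => hL w ?_
  rintro rfl
  rw [← hm] at hw
  exact PrefList.irrefl _ _ (by simpa [withList] using hw)

theorem IsPushUp.isStable_withList_iff (hL : P.IsPushUp m F L) (hm : ν m = P.DA m) :
    (P.withList m L).IsStable ν ↔ P.IsAdmissible m F ν := by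
  constructor
  · intro h
    have hself := fun w => mt (hL.blocks_withList_iff hm (w := w)).2 (h m w)
    refine ⟨fun a w hblocks => ?_, hm, fun x hx => ?_⟩
    · rcases eq_or_ne a m with rfl | ha
      · exact hself w (Or.inl hblocks)
      · exact h a w ((blocks_withList_of_ne ha).2 hblocks)
    · by_contra hx'
      exact hself x (Or.inr ⟨hx, hx'⟩)
  · intro h a w hblocks
    rcases eq_or_ne a m with rfl | ha
    · rcases (hL.blocks_withList_iff hm).1 hblocks with hP | ⟨hw, hw'⟩
      · exact h.isStable a w hP
      · exact hw' (h.declines w hw)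
    · exact h.isStable a w ((blocks_withList_of_ne ha).1 hblocks)

theorem isAdmissible_pushUpMatching (hm : P.pushUpMatching m up F m = P.DA m) :
    P.IsAdmissible m F (P.pushUpMatching m up F) :=
  ((up F).2.isStable_withList_iff hm).1 (P.withList m (up F).1).DA_isStable

theorem IsAdmissible.womenWeaklyPrefer_pushUpMatching (hν : P.IsAdmissible m F ν)
    (up : P.PushUpRule m) : P.WomenWeaklyPrefer ν (P.pushUpMatching m up F) :=
  (((up F).2.isStable_withList_iff hν.apply_eq).2 hν).womenWeaklyPrefer_DA

theorem pushUpMatching_singleton_apply {y : W} (hy : y ∈ P.noRegretSet m up) :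
    P.pushUpMatching m up {y} m = P.DA m := by
  have hle : (P.men m).weaklyPrefers (P.pushUpMatching m up {y} m) (P.DA m) := by
    simpa [noRegretSet] using hy
  exact hle.resolve_left (P.DA_strategyproof m _)

theorem isAdmissible_pushUpMatching_singleton {y : W} (hy : y ∈ P.noRegretSet m up) :
    P.IsAdmissible m {y} (P.pushUpMatching m up {y}) := by
  simpa using isAdmissible_pushUpMatching (pushUpMatching_singleton_apply hy)

theorem pushUpMatching_apply_of_isAdmissible (hF : F ⊆ P.noRegretSet m up)
    (hν : P.IsAdmissible m F ν) : P.pushUpMatching m up F m = P.DA m := by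
  by_contra hne
  have hle : (up F).1.weaklyPrefers (P.pushUpMatching m up F m) (P.DA m) := by
    have h := (((up F).2.isStable_withList_iff hν.apply_eq).2 hν).men_weaklyPrefer_DA m
    rwa [withList_men_self, hν.apply_eq] at h
  rcases ((up F).2 _ hne).1 (hle.resolve_right hne) with htrue | hmem
  · exact P.DA_strategyproof m _ htrue
  · -- A man whose true list is the one pushing up only `x` would gain by reporting `up F`.
    set x := P.pushUpMatching m up F m
    have hsingle := (P.withList m (up {x}).1).DA_strategyproof m (up F).1
    rw [withList_withList, withList_men_self] at hsingle
    change ¬ (up {x}).1.prefers x (P.pushUpMatching m up {x} m) at hsingle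
    rw [pushUpMatching_singleton_apply (hF hmem)] at hsingle
    exact hsingle (((up {x}).2 x hne).2 (Or.inr (Finset.mem_singleton_self x)))

theorem exists_isAdmissible_of_subset_noRegretSet (hF : F ⊆ P.noRegretSet m up) :
    ∃ ν, P.IsAdmissible m F ν ∧ ∀ w, P.Declines m ν w →
      P.Declines m P.DA w ∨ ∃ y ∈ F, P.Declines m (P.pushUpMatching m up {y}) w := by
  have hsingle : ∀ y ∈ F, P.IsAdmissible m {y} (P.pushUpMatching m up {y}) := fun y hy =>
    isAdmissible_pushUpMatching_singleton (hF hy)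
  obtain ⟨ν, hν, hsel⟩ := exists_isAdmissible_sup (P := P) (m := m) (X := F)
    (S := insert P.DA ((fun y => P.pushUpMatching m up {y}) '' F)) (Set.insert_nonempty _ _)
    (Set.forall_mem_insert.2 ⟨P.DA_isAdmissible_empty m,
      Set.forall_mem_image.2 fun y hy => (hsingle y hy).mono (Set.empty_subset _)⟩)
    (fun y hy => ⟨_, Or.inr ⟨y, hy, rfl⟩, (hsingle y hy).declines y rfl⟩)
  exact ⟨ν, hν, fun w hw => by
    simpa only [Set.exists_mem_insert, Set.exists_mem_image, Finset.mem_coe] using hsel w hw⟩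

theorem isAdmissible_pushUpMatching_of_subset (hF : F ⊆ P.noRegretSet m up) :
    P.IsAdmissible m F (P.pushUpMatching m up F) :=
  have ⟨_, hν, _⟩ := exists_isAdmissible_of_subset_noRegretSet hF
  isAdmissible_pushUpMatching (pushUpMatching_apply_of_isAdmissible hF hν)

theorem mem_declineClosure_iff_declines_pushUpMatching {w : W} (hF : F ⊆ P.noRegretSet m up) :
    w ∈ P.declineClosure m F ↔ P.Declines m (P.pushUpMatching m up F) w :=
  (isAdmissible_pushUpMatching_of_subset hF).mem_declineClosure_iff
    fun _ hν => hν.womenWeaklyPrefer_pushUpMatching up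

theorem mem_declineClosure_empty_or_singleton (hF : F ⊆ P.noRegretSet m up) :
    ∀ w ∈ P.declineClosure m F,
      w ∈ P.declineClosure m ∅ ∨ ∃ y ∈ F, w ∈ P.declineClosure m {y} := by
  intro w hw
  obtain ⟨ν, hν, hsel⟩ := exists_isAdmissible_of_subset_noRegretSet hF
  refine (hsel w (hw ν hν)).imp mem_declineClosure_empty ?_
  rintro ⟨y, hy, hyw⟩
  refine ⟨y, hy, ?_⟩
  rwa [← Finset.coe_singleton, mem_declineClosure_iff_declines_pushUpMatching
    (Finset.singleton_subset_iff.2 (hF hy))]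

theorem pushUpMatching_eq_noRegretSet_iff (hF : F ⊆ P.noRegretSet m up) :
    P.pushUpMatching m up F = P.pushUpMatching m up (P.noRegretSet m up) ↔
      (P.noRegretSet m up : Set W) ⊆ P.declineClosure m F := by
  have hadm := isAdmissible_pushUpMatching_of_subset hF
  have hadmN := isAdmissible_pushUpMatching_of_subset (Finset.Subset.refl (P.noRegretSet m up))
  constructor
  · intro heq x hx
    rw [mem_declineClosure_iff_declines_pushUpMatching hF, heq]
    exact hadmN.declines x hx
  · intro hsub
    have hadm' : P.IsAdmissible m (P.noRegretSet m up) (P.pushUpMatching m up F) :=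
      ⟨hadm.isStable, hadm.apply_eq, fun x hx => hsub hx _ hadm⟩
    exact (hadm'.womenWeaklyPrefer_pushUpMatching up).antisymm
      ((hadmN.mono (Finset.coe_subset.2 hF)).womenWeaklyPrefer_pushUpMatching up)

theorem IsMinimalNoRegretPushUpSet.notMem_declineClosure_diff
    (hF : P.IsMinimalNoRegretPushUpSet m up F) :
    ∀ y ∈ F, y ∉ P.declineClosure m (F \ {y}) := by
  classical
  obtain ⟨hFN, heq, hmin⟩ := hF
  intro y hy hmem
  have hsub : F.erase y ⊆ P.noRegretSet m up := (F.erase_subset y).trans hFN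
  refine hmin ⟨F.erase y, (pushUpMatching_eq_noRegretSet_iff hsub).2 ?_, F.erase_ssubset hy⟩
  rw [Finset.coe_erase, closure_diff_singleton_of_mem hmem]
  exact (pushUpMatching_eq_noRegretSet_iff hFN).1 heq

end Profile

end StableMarriage

theorem mainTheorem3 {M W : Type*} [Fintype M] [Fintype W]
    (P : StableMarriage.Profile M W) (m : M) (up : P.PushUpRule m) (Y : Finset W)
    (hY : P.IsMinimalNoRegretPushUpSet m up Y) :
    P.IsMinimumNoRegretPushUpSet m up Y := by
  have hind := hY.notMem_declineClosure_diff
  obtain ⟨hYN, hYeq, -⟩ := hY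
  refine ⟨hYN, hYeq, ?_⟩
  rintro ⟨Z, hZN, hZeq, hlt⟩
  have hgenY := (StableMarriage.Profile.pushUpMatching_eq_noRegretSet_iff hYN).1 hYeq
  have hgenZ := (StableMarriage.Profile.pushUpMatching_eq_noRegretSet_iff hZN).1 hZeq
  have hcard : Y.card ≤ Z.card := StableMarriage.card_le_card_of_independent hind
    ((Finset.coe_subset.2 hYN).trans hgenZ) ((Finset.coe_subset.2 hZN).trans hgenY)
    (StableMarriage.Profile.mem_declineClosure_empty_or_singleton hYN)
    (StableMarriage.Profile.mem_declineClosure_empty_or_singleton hZN)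
  exact hcard.not_gt hlt
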